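/- Let $\kappa>0$, let $\overline{\mathbb H}=\{z\in\mathbb C:\operatorname{Im} z\ge 0\}$, and let $(B_t)_{t\ge0}$ be a standard real Brownian motion with $B_0=0$. For $z\in\overline{\mathbb H}\setminus\{0\}$ let $g_t(z)$ be the solution of the Löwner equation $$\partial_t g_t(z)=\frac{2}{g_t(z)-\sqrt{\kappa}\,B_t},\qquad g_0(z)=z,$$ which exists up to the time $\tau(z)\in(0,\infty]$, the first time $\tau$ at which $\lim_{t\uparrow\tau}(g_t(z)-\sqrt{\kappa}B_t)=0$ (with $\tau(z)=\infty$ if this never happens); put $\tau(0)=0$ and let $K_t=\{z\in\overline{\mathbb H}:\tau(z)\le t\}$. Thus $(g_t)_{t\ge0}$ are the maps and $(K_t)_{t\ge0}$ the hulls of chordal $\mathrm{SLE}_\kappa$. Regard $g_t(z)$ as taking an extra isolated value "undefined" for $t\ge\tau(z)$, and regard $K_t$ as a random set with respect to the $\sigma$-algebra generated by the events $\{K\cap C\neq\emptyset\}$, $C\subset\mathbb C$ compact. For every $\alpha>0$: 1. the process $(t,z)\mapsto \alpha^{-1/2}g_{\alpha t}(\sqrt{\alpha}\,z)$, indexed by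 $t\ge0$ and $z\in\overline{\mathbb H}\setminus\{0\}$, has the same distribution (law on the product $\sigma$-algebra) as the process $(t,z)\mapsto g_t(z)$; 2. the process $t\mapsto\alpha^{-1/2}K_{\alpha t}$, $t\ge 0$, has the same distribution as the process $t\mapsto K_t$. -/

import Mathlib

open MeasureTheory ProbabilityTheory Filter Topology
open scoped NNReal ENNReal

noncomputable section

namespace ChordalSLE

/-- `g` solves the Loewner equation `∂ₜ g(t) = 2 / (g(t) - U(t))`, `g(0) = z`, on the time
interval `[0, T)`, the denominator being nonzero there (the derivative at `t = 0` is
one-sided). -/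
def IsLoewnerSolution (U : ℝ≥0 → ℝ) (z : ℂ) (T : ℝ) (g : ℝ → ℂ) : Prop :=
  g 0 = z ∧ ∀ t : ℝ, 0 ≤ t → t < T →
    g t - (U t.toNNReal : ℂ) ≠ 0 ∧
    HasDerivWithinAt g (2 / (g t - (U t.toNNReal : ℂ))) (Set.Ici 0) t

/-- `T` is a time at which the solution started from `z` hits the driving function:
`g(t) - U(t) → 0` as `t ↑ T`. For the singular starting point `z = U(0)` this is `T = 0`. -/
def IsSwallowingTime (U : ℝ≥0 → ℝ) (z : ℂ) (T : ℝ≥0) : Prop :=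
  (T = 0 ∧ z = (U 0 : ℂ)) ∨
  (0 < T ∧ ∃ g : ℝ → ℂ, IsLoewnerSolution U z T g ∧
    Tendsto (fun t : ℝ => g t - (U t.toNNReal : ℂ)) (𝓝[<] (T : ℝ)) (𝓝 0))

/-- `τ(z)`: the first time `τ` with `lim_{t ↑ τ} (g_t(z) - U_t) = 0`, and `∞` if there is none. -/
def swallowingTime (U : ℝ≥0 → ℝ) (z : ℂ) : ℝ≥0∞ :=
  ⨅ (T : ℝ≥0) (_ : IsSwallowingTime U z T), (T : ℝ≥0∞)

open Classical in
/-- The Loewner map `g_t(z)`: the value at time `t` of the solution started from `z`, and `none`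
if there is no solution on a time interval `[0, T)` with `T > t`. -/
def loewnerMap (U : ℝ≥0 → ℝ) (t : ℝ≥0) (z : ℂ) : Option ℂ :=
  if h : ∃ g : ℝ → ℂ, ∃ T : ℝ, (t : ℝ) < T ∧ IsLoewnerSolution U z T g then
    some (h.choose t)
  else none

/-- Subsets of the plane, as values of random sets. -/
def PlaneSet : Type := Set ℂ

/-- The usual σ-algebra for random closed sets (the Borel σ-algebra of the Fell topology),
generated by the events `{K | K ∩ C ≠ ∅}` with `C` compact. -/
instance : MeasurableSpace PlaneSet :=
  MeasurableSpace.generateFrom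
    {A : Set PlaneSet | ∃ C : Set ℂ, IsCompact C ∧
      A = {K : PlaneSet | ∃ z : ℂ, z ∈ (show Set ℂ from K) ∧ z ∈ C}}

/-- The σ-algebra on `ℂ` with one isolated point `none` added (for "undefined"): a set is
measurable if and only if its trace on `ℂ` is Borel. -/
instance : MeasurableSpace (Option ℂ) :=
  MeasurableSpace.map (some : ℂ → Option ℂ) inferInstance

/-- The hull `K_t = {z ∈ closed upper half-plane : τ(z) ≤ t}`. -/
def loewnerHull (U : ℝ≥0 → ℝ) (t : ℝ≥0) : PlaneSet :=
  {z : ℂ | 0 ≤ z.im ∧ swallowingTime U z ≤ (t : ℝ≥0∞)}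

/-- The set `c K = {c z : z ∈ K}`. -/
def PlaneSet.scale (c : ℝ) (K : PlaneSet) : PlaneSet :=
  (fun z : ℂ => (c : ℂ) * z) '' (show Set ℂ from K)

/-- The closed upper half-plane without the origin. -/
abbrev PuncturedHalfPlane : Type := {z : ℂ // 0 ≤ z.im ∧ z ≠ 0}

variable {Ω : Type*}

/-- The driving function `t ↦ √κ B_t(ω)`. -/
def driving (κ : ℝ) (B : ℝ≥0 → Ω → ℝ) (ω : Ω) (t : ℝ≥0) : ℝ := √κ * B t ω

/-- The maps `g_t(z)` of chordal SLE_κ driven by the Brownian motion `B`. -/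
def sleMap (κ : ℝ) (B : ℝ≥0 → Ω → ℝ) (ω : Ω) (t : ℝ≥0) (z : ℂ) : Option ℂ :=
  loewnerMap (driving κ B ω) t z

/-- The hulls `K_t` of chordal SLE_κ driven by the Brownian motion `B`. -/
def sleHull (κ : ℝ) (B : ℝ≥0 → Ω → ℝ) (ω : Ω) (t : ℝ≥0) : PlaneSet :=
  loewnerHull (driving κ B ω) t

end ChordalSLE

end

noncomputable section

namespace ChordalSLE

/-! If g solves the Loewner equation driven by U, then s ↦ a⁻¹ g(a² s) solves it for the driver s ↦
a⁻¹ U(a² s) and the starting point a⁻¹ z. With a = √α the new driver is √κ times a rescaled Brownian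
motion, hence equal in law to the old one. Both claims follow once maps and hulls are shown to be
measurable functions of the continuous driving path (`identDistrib_of_rescale`).

Measurability rests on stability of the ODE. The field is made globally Lipschitz by truncation near
its singularity, and Grönwall's inequality (`exists_of_close`) shows that the set of pairs (path,
point) where g_t is defined is open and that g_t is continuous there. A hull misses a compact set
exactly when g_t is defined on the part of it in the closed half-plane, which by compactness is an
open condition on the path. This uses `swallowingTime_le_iff`: being swallowed by time t is the same
as g_t being undefined, because a solution can fail to continue only by running into the driver. -/

/-! ### The truncated Loewner vector field -/

/-- A globally Lipschitz function of `w` that agrees with `w⁻¹` for `c ≤ ‖w‖`. -/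
def truncInv (c : ℝ) (w : ℂ) : ℂ := (starRingEnd ℂ) w / ((max ‖w‖ c : ℝ) : ℂ) ^ 2

theorem truncInv_eq_inv {c : ℝ} {w : ℂ} (h : c ≤ ‖w‖) : truncInv c w = w⁻¹ := by
  rw [truncInv, max_eq_left h, Complex.inv_def, Complex.normSq_eq_norm_sq, div_eq_mul_inv]
  push_cast
  rfl

theorem norm_truncInv_le {c : ℝ} (hc : 0 < c) (w : ℂ) : ‖truncInv c w‖ ≤ 1 / c := by
  have hM : 0 < max ‖w‖ c := lt_max_of_lt_right hc
  rw [truncInv, norm_div, norm_pow, Complex.norm_conj, Complex.norm_real, Real.norm_eq_abs,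
    abs_of_pos hM, div_le_div_iff₀ (by positivity) hc, one_mul, sq]
  exact mul_le_mul (le_max_left _ _) (le_max_right _ _) hc.le hM.le

/-- Changing the numerator over the fixed denominator M² costs 1/c²; changing the denominator costs
1/M² + 1/(MN) ≤ 2/c², because ‖v‖ ≤ N absorbs one factor. -/
theorem norm_truncInv_sub_le {c : ℝ} (hc : 0 < c) (w v : ℂ) :
    ‖truncInv c w - truncInv c v‖ ≤ 3 / c ^ 2 * ‖w - v‖ := by
  set M := max ‖w‖ c with hM
  set N := max ‖v‖ c with hN
  have hMc : c ≤ M := le_max_right _ _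
  have hNc : c ≤ N := le_max_right _ _
  have hvN : ‖v‖ ≤ N := le_max_left _ _
  have hM0 : 0 < M := hc.trans_le hMc
  have hN0 : 0 < N := hc.trans_le hNc
  have hMN : |N - M| ≤ ‖w - v‖ := by
    rw [abs_sub_comm]
    exact (abs_max_sub_max_le_abs _ _ _).trans (abs_norm_sub_norm_le w v)
  have key : truncInv c w - truncInv c v
      = (starRingEnd ℂ) (w - v) / (M : ℂ) ^ 2
        + (starRingEnd ℂ) v * (((N - M) * (N + M) / (M ^ 2 * N ^ 2) : ℝ) : ℂ) := by
    have h1 : (M : ℂ) ≠ 0 := by exact_mod_cast hM0.ne'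
    have h2 : (N : ℂ) ≠ 0 := by exact_mod_cast hN0.ne'
    simp only [truncInv, ← hM, ← hN, map_sub]
    push_cast
    field_simp
    ring
  rw [key]
  refine (norm_add_le _ _).trans ?_
  have e1 : ‖(starRingEnd ℂ) (w - v) / (M : ℂ) ^ 2‖ ≤ 1 / c ^ 2 * ‖w - v‖ := by
    rw [norm_div, norm_pow, Complex.norm_conj, Complex.norm_real, Real.norm_eq_abs,
      abs_of_pos hM0, div_eq_inv_mul, one_div]
    gcongr
  have e2 : ‖(starRingEnd ℂ) v * (((N - M) * (N + M) / (M ^ 2 * N ^ 2) : ℝ) : ℂ)‖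
      ≤ 2 / c ^ 2 * ‖w - v‖ := by
    rw [norm_mul, Complex.norm_conj, Complex.norm_real, Real.norm_eq_abs, abs_div, abs_mul,
      abs_of_pos (add_pos hN0 hM0), abs_of_pos (show 0 < M ^ 2 * N ^ 2 by positivity)]
    calc ‖v‖ * (|N - M| * (N + M) / (M ^ 2 * N ^ 2))
        ≤ N * (‖w - v‖ * (N + M) / (M ^ 2 * N ^ 2)) := by gcongr
      _ = (1 / (M * M) + 1 / (M * N)) * ‖w - v‖ := by field_simp
      _ ≤ (1 / (c * c) + 1 / (c * c)) * ‖w - v‖ := by gcongr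
      _ = 2 / c ^ 2 * ‖w - v‖ := by ring
  calc _ ≤ 1 / c ^ 2 * ‖w - v‖ + 2 / c ^ 2 * ‖w - v‖ := add_le_add e1 e2
    _ = _ := by ring

/-- The Loewner vector field, with the singularity removed by truncation at distance `c`. -/
def truncField (U : ℝ≥0 → ℝ) (c s : ℝ) (w : ℂ) : ℂ := 2 * truncInv c (w - (U s.toNNReal : ℂ))

theorem lipschitzWith_truncField (U : ℝ≥0 → ℝ) {c : ℝ} (hc : 0 < c) (s : ℝ) :
    LipschitzWith (6 / c ^ 2).toNNReal (truncField U c s) := by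
  refine LipschitzWith.of_dist_le_mul fun w v => ?_
  have h := norm_truncInv_sub_le hc (w - (U s.toNNReal : ℂ)) (v - (U s.toNNReal : ℂ))
  rw [sub_sub_sub_cancel_right] at h
  rw [Real.coe_toNNReal _ (by positivity), dist_eq_norm, dist_eq_norm, truncField, truncField,
    ← mul_sub, norm_mul, Complex.norm_ofNat]
  calc _ ≤ 2 * (3 / c ^ 2 * ‖w - v‖) := by gcongr
    _ = _ := by ring

theorem dist_truncField_le (U V : ℝ≥0 → ℝ) {c : ℝ} (hc : 0 < c) (s : ℝ) (w : ℂ) :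
    dist (truncField U c s w) (truncField V c s w)
      ≤ 6 / c ^ 2 * |V s.toNNReal - U s.toNNReal| := by
  have h := norm_truncInv_sub_le hc (w - (U s.toNNReal : ℂ)) (w - (V s.toNNReal : ℂ))
  rw [sub_sub_sub_cancel_left, ← Complex.ofReal_sub, Complex.norm_real, Real.norm_eq_abs] at h
  rw [dist_eq_norm, truncField, truncField, ← mul_sub, norm_mul, Complex.norm_ofNat]
  calc _ ≤ 2 * (3 / c ^ 2 * |V s.toNNReal - U s.toNNReal|) := by gcongr
    _ = _ := by ring

theorem continuous_truncInv {c : ℝ} (hc : 0 < c) : Continuous (truncInv c) :=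
  (LipschitzWith.of_dist_le_mul (K := (3 / c ^ 2).toNNReal) fun w v => by
    rw [Real.coe_toNNReal _ (by positivity), dist_eq_norm, dist_eq_norm]
    exact norm_truncInv_sub_le hc w v).continuous

/-- The truncated field is bounded by 2/c, so Picard–Lindelöf on the ball of radius (2/c)b reaches
time b with no smallness condition. -/
theorem exists_truncField_solution {U : ℝ≥0 → ℝ} (hU : Continuous U) (z : ℂ) {c b : ℝ}
    (hc : 0 < c) (hb : 0 ≤ b) :
    ∃ h : ℝ → ℂ, h 0 = z ∧ ∀ s ∈ Set.Icc 0 b,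
      HasDerivWithinAt h (truncField U c s (h s)) (Set.Icc 0 b) s := by
  have hP : IsPicardLindelof (truncField U c) (⟨0, le_rfl, hb⟩ : Set.Icc (0 : ℝ) b) z
      (2 / c * b).toNNReal 0 (2 / c).toNNReal (6 / c ^ 2).toNNReal := by
    refine ⟨fun s _ => (lipschitzWith_truncField U hc s).lipschitzOnWith, fun w _ => ?_,
      fun s _ w _ => ?_, ?_⟩
    · have : Continuous fun s : ℝ => truncField U c s w := by
        unfold truncField
        have := continuous_truncInv hc
        have := hU.comp continuous_real_toNNReal
        simp only [Function.comp_def] at this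
        fun_prop
      exact this.continuousOn
    · rw [Real.coe_toNNReal _ (by positivity), truncField, norm_mul, Complex.norm_ofNat]
      calc _ ≤ 2 * (1 / c) := by gcongr; exact norm_truncInv_le hc _
        _ = _ := by ring
    · rw [Real.coe_toNNReal _ (by positivity), Real.coe_toNNReal _ (by positivity)]
      simp [hb]
  exact hP.exists_eq_forall_mem_Icc_hasDerivWithinAt₀

theorem continuous_driving_ofReal {U : ℝ≥0 → ℝ} (hU : Continuous U) :
    Continuous fun s : ℝ => (U s.toNNReal : ℂ) :=
  Complex.continuous_ofReal.comp (hU.comp continuous_real_toNNReal)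

theorem truncField_eq (U : ℝ≥0 → ℝ) {c s : ℝ} {w : ℂ} (h : c ≤ ‖w - (U s.toNNReal : ℂ)‖) :
    truncField U c s w = 2 / (w - (U s.toNNReal : ℂ)) := by
  rw [truncField, truncInv_eq_inv h, div_eq_mul_inv]

/-! ### Uniqueness, continuation and stability of Loewner solutions -/

namespace IsLoewnerSolution

variable {U : ℝ≥0 → ℝ} {z : ℂ} {T : ℝ} {g h : ℝ → ℂ}

theorem continuousOn (hg : IsLoewnerSolution U z T g) {b : ℝ} (hb : b < T) :
    ContinuousOn g (Set.Icc 0 b) := fun t ht =>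
  ((hg.2 t ht.1 (ht.2.trans_lt hb)).2.continuousWithinAt).mono Set.Icc_subset_Ici_self

theorem hasDerivWithinAt_Ici (hg : IsLoewnerSolution U z T g) {t : ℝ} (h0 : 0 ≤ t) (ht : t < T) :
    HasDerivWithinAt g (2 / (g t - (U t.toNNReal : ℂ))) (Set.Ici t) t :=
  (hg.2 t h0 ht).2.mono (Set.Ici_subset_Ici.2 h0)

theorem exists_lower_bound (hU : Continuous U) (hg : IsLoewnerSolution U z T g) {b : ℝ}
    (hb : b < T) : ∃ m : ℝ, 0 < m ∧ ∀ s ∈ Set.Icc 0 b, m ≤ ‖g s - (U s.toNNReal : ℂ)‖ := by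
  have hc : ContinuousOn (fun s => ‖g s - (U s.toNNReal : ℂ)‖) (Set.Icc 0 b) :=
    ((hg.continuousOn hb).sub (continuous_driving_ofReal hU).continuousOn).norm
  obtain h | h := (Set.Icc (0 : ℝ) b).eq_empty_or_nonempty
  · exact ⟨1, one_pos, by simp [h]⟩
  · obtain ⟨x, hx, hmin⟩ := isCompact_Icc.exists_isMinOn h hc
    exact ⟨_, norm_pos_iff.2 (hg.2 x hx.1 (hx.2.trans_lt hb)).1, fun s hs => hmin hs⟩

/-- Solutions of the truncated equation agree with Loewner solutions away from the singularity. -/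
theorem eqOn_of_lower_bound (hg : IsLoewnerSolution U z T g) {c b : ℝ} (hc : 0 < c) (hb : b < T)
    (hm : ∀ s ∈ Set.Icc 0 b, c ≤ ‖g s - (U s.toNNReal : ℂ)‖)
    (h0 : h 0 = z) (hcont : ContinuousOn h (Set.Icc 0 b))
    (hh : ∀ s ∈ Set.Ico 0 b, HasDerivWithinAt h (truncField U c s (h s)) (Set.Ici s) s) :
    Set.EqOn g h (Set.Icc 0 b) := by
  refine ODE_solution_unique_of_mem_Icc_right (v := truncField U c) (s := fun _ => Set.univ)
    (fun s _ => (lipschitzWith_truncField U hc s).lipschitzOnWith) (hg.continuousOn hb)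
    (fun s hs => ?_) (fun _ _ => trivial) hcont hh (fun _ _ => trivial) (hg.1.trans h0.symm)
  rw [truncField_eq U (hm s ⟨hs.1, hs.2.le⟩)]
  exact hg.hasDerivWithinAt_Ici hs.1 (hs.2.trans hb)

/-- On [0, t] both solutions keep a positive distance from the driver, so both solve one and the
same Lipschitz truncated equation. -/
theorem unique (hU : Continuous U) {T' : ℝ} (hg : IsLoewnerSolution U z T g)
    (hh : IsLoewnerSolution U z T' h) {t : ℝ} (h0 : 0 ≤ t) (ht : t < T) (ht' : t < T') :
    g t = h t := by
  obtain ⟨m, hm, hgm⟩ := hg.exists_lower_bound hU ht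
  obtain ⟨m', hm', hhm⟩ := hh.exists_lower_bound hU ht'
  refine hg.eqOn_of_lower_bound (lt_min hm hm') ht (fun s hs => (min_le_left _ _).trans (hgm s hs))
    hh.1 (hh.continuousOn ht') (fun s hs => ?_) ⟨h0, le_rfl⟩
  rw [truncField_eq U ((min_le_right _ _).trans (hhm s ⟨hs.1, hs.2.le⟩))]
  exact hh.hasDerivWithinAt_Ici hs.1 (hs.2.trans ht')

/-- A solution of the truncated equation that stays away from the singularity on `[0, b]` solves
the Loewner equation past `b`. -/
theorem of_truncField (hU : Continuous U) {c b b' : ℝ} (hc : 0 < c) (hb : 0 ≤ b) (hbb : b < b')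
    (h0 : h 0 = z)
    (hh : ∀ s ∈ Set.Icc 0 b', HasDerivWithinAt h (truncField U c s (h s)) (Set.Icc 0 b') s)
    (hm : ∀ s ∈ Set.Icc 0 b, c < ‖h s - (U s.toNNReal : ℂ)‖) :
    ∃ T, b < T ∧ IsLoewnerSolution U z T h := by
  have hcont : ContinuousWithinAt (fun s => ‖h s - (U s.toNNReal : ℂ)‖) (Set.Icc 0 b') b :=
    ((hh b ⟨hb, hbb.le⟩).continuousWithinAt.sub
      (continuous_driving_ofReal hU).continuousWithinAt).norm
  have hev : ∀ᶠ s in 𝓝[≥] b, c < ‖h s - (U s.toNNReal : ℂ)‖ := by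
    have h1 := hcont.eventually (lt_mem_nhds (hm b ⟨hb, le_rfl⟩))
    have h2 : Set.Icc b b' ⊆ Set.Icc 0 b' := Set.Icc_subset_Icc_left hb
    have h3 := h1.filter_mono (nhdsWithin_mono b h2)
    rwa [nhdsWithin_Icc_eq_nhdsGE hbb] at h3
  obtain ⟨d, hd, hsub⟩ := (mem_nhdsGE_iff_exists_Ico_subset' hbb).1 hev
  refine ⟨min d b', lt_min hd hbb, h0, fun t ht0 ht => ?_⟩
  have hlt : c < ‖h t - (U t.toNNReal : ℂ)‖ := by
    rcases le_or_gt t b with htb | htb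
    · exact hm t ⟨ht0, htb⟩
    · exact hsub ⟨htb.le, ht.trans_le (min_le_left _ _)⟩
  have htb' : t < b' := ht.trans_le (min_le_right _ _)
  refine ⟨norm_pos_iff.1 (hc.trans hlt), ?_⟩
  have := hh t ⟨ht0, htb'.le⟩
  rw [truncField_eq U hlt.le] at this
  refine this.mono_of_mem_nhdsWithin ?_
  have := Iic_mem_nhds htb'
  rw [← Set.Ici_inter_Iic]
  exact inter_mem self_mem_nhdsWithin (mem_nhdsWithin_of_mem_nhds this)

/-- The truncated solution exists beyond b and coincides with g before b; the lower bound passes to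
b by continuity, so the truncation is still inactive slightly later. -/
theorem exists_of_lower_bound (hU : Continuous U) {b c : ℝ} (hb : 0 ≤ b) (hc : 0 < c)
    (hz : z ≠ (U 0 : ℂ)) (hg : IsLoewnerSolution U z b g)
    (hm : ∀ s ∈ Set.Ico 0 b, c ≤ ‖g s - (U s.toNNReal : ℂ)‖) :
    ∃ T h, b < T ∧ IsLoewnerSolution U z T h := by
  have hz' : 0 < ‖z - (U 0 : ℂ)‖ := norm_pos_iff.2 (sub_ne_zero.2 hz)
  -- The second term covers b = 0, where `hm` is vacuous. Truncating at e/2 leaves a strict margin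
  -- at b.
  set e := min c ‖z - (U 0 : ℂ)‖ with he
  have he0 : 0 < e := lt_min hc hz'
  obtain ⟨h, h0, hh⟩ := exists_truncField_solution hU z (half_pos he0) (b := b + 1) (by linarith)
  have hcont : ContinuousOn h (Set.Icc 0 b) := fun s hs =>
    (hh s ⟨hs.1, by linarith [hs.2]⟩).continuousWithinAt.mono
      (Set.Icc_subset_Icc_right (by linarith))
  have hle : ∀ s ∈ Set.Ico 0 b, e ≤ ‖h s - (U s.toNNReal : ℂ)‖ := by
    intro s hs
    have := hg.eqOn_of_lower_bound (half_pos he0) hs.2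
      (fun r hr => (half_le_self he0.le).trans ((min_le_left _ _).trans
        (hm r ⟨hr.1, hr.2.trans_lt hs.2⟩))) h0
      (hcont.mono (Set.Icc_subset_Icc_right hs.2.le)) (fun r hr => ?_) ⟨hs.1, le_rfl⟩
    · rw [← this]
      exact (min_le_left _ _).trans (hm s hs)
    · have hr' : r < b + 1 := by linarith [hr.2, hs.2]
      refine (hh r ⟨hr.1, hr'.le⟩).mono_of_mem_nhdsWithin ?_
      refine mem_of_superset (Icc_mem_nhdsGE hr') (Set.Icc_subset_Icc_left hr.1)
  have hle' : ∀ s ∈ Set.Icc 0 b, e ≤ ‖h s - (U s.toNNReal : ℂ)‖ := by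
    intro s hs
    rcases hs.2.lt_or_eq with hsb | rfl
    · exact hle s ⟨hs.1, hsb⟩
    rcases hb.eq_or_lt with rfl | hb'
    · rw [h0, Real.toNNReal_zero]
      exact min_le_right _ _
    · have hc1 : ContinuousWithinAt (fun s => ‖h s - (U s.toNNReal : ℂ)‖) (Set.Ico 0 s) s :=
        ((hcont s ⟨hb, le_rfl⟩).mono Set.Ico_subset_Icc_self |>.sub
          (continuous_driving_ofReal hU).continuousWithinAt).norm
      refine ContinuousWithinAt.closure_le (f := fun _ => e)
        (g := fun s => ‖h s - (U s.toNNReal : ℂ)‖) ?_ continuousWithinAt_const hc1 hle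
      rw [closure_Ico hb'.ne]
      exact ⟨hb, le_rfl⟩
  obtain ⟨T, hT, hs⟩ := of_truncField hU (half_pos he0) hb (by linarith : b < b + 1) h0 hh
    (fun s hs => (half_lt_self he0).trans_le (hle' s hs))
  exact ⟨T, h, hT, hs⟩

/-- Solutions depend continuously on the driving function and the starting point. -/
theorem exists_of_close (hU : Continuous U) (hg : IsLoewnerSolution U z T g) {t : ℝ}
    (h0 : 0 ≤ t) (ht : t < T) {ε : ℝ} (hε : 0 < ε) :
    ∃ δ > 0, ∀ V : ℝ≥0 → ℝ, Continuous V → ∀ w : ℂ,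
      (∀ s : ℝ≥0, (s : ℝ) ≤ t → |V s - U s| ≤ δ) → ‖w - z‖ ≤ δ →
      ∃ T' h, t < T' ∧ IsLoewnerSolution V w T' h ∧ ‖h t - g t‖ ≤ ε := by
  obtain ⟨m, hm, hgm⟩ := hg.exists_lower_bound hU ht
  -- If h stays within m/4 of g and V within m/4 of U, then h stays at least m/2 from V, and the
  -- truncation at m/4 is never active.
  have hc : 0 < m / 4 := by positivity
  set K : ℝ := 6 / (m / 4) ^ 2 with hK
  have hK0 : 0 < K := by positivity
  -- Grönwall factor: initial error δ and field error Kδ give at most δM at time t.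
  set M : ℝ := Real.exp (K * t) + (Real.exp (K * t) - 1) with hM
  have hexp : 1 ≤ Real.exp (K * t) := Real.one_le_exp (by positivity)
  have hM0 : 0 < M := by linarith
  refine ⟨min (m / 4) (min ε (m / 4) / M), lt_min hc (div_pos (lt_min hε hc) hM0),
    fun V hV w hVU hwz => ?_⟩
  set δ := min (m / 4) (min ε (m / 4) / M) with hδ
  have hδ0 : 0 < δ := lt_min hc (div_pos (lt_min hε hc) hM0)
  obtain ⟨h, hh0, hh⟩ := exists_truncField_solution hV w hc (b := t + 1) (by linarith)
  have hclose : ∀ s ∈ Set.Icc 0 t, ‖h s - g s‖ ≤ min ε (m / 4) := by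
    intro s hs
    have hG := dist_le_of_approx_trajectories_ODE (v := truncField V (m / 4)) (a := 0) (b := t)
      (K := (6 / (m / 4) ^ 2).toNNReal) (f := h) (g := g)
      (f' := fun s => truncField V (m / 4) s (h s))
      (g' := fun s => truncField U (m / 4) s (g s)) (εf := 0) (εg := K * δ) (δ := δ)
      (fun s => lipschitzWith_truncField V hc s)
      (fun s hs => (hh s ⟨hs.1, by linarith [hs.2]⟩).continuousWithinAt.mono
        (Set.Icc_subset_Icc_right (by linarith)))
      (fun r hr => ?_) (fun _ _ => by simp) (hg.continuousOn ht) (fun r hr => ?_)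
      (fun r hr => ?_) ?_ s hs
    · rw [dist_eq_norm] at hG
      refine hG.trans ?_
      rw [Real.coe_toNNReal _ (by positivity), ← hK, zero_add, sub_zero,
        gronwallBound_of_K_ne_0 hK0.ne']
      have h1 : Real.exp (K * s) ≤ Real.exp (K * t) := by
        gcongr
        exact hs.2
      have h2 : δ * M ≤ min ε (m / 4) := by
        have : δ ≤ min ε (m / 4) / M := min_le_right _ _
        rwa [le_div_iff₀ hM0] at this
      calc _ = δ * (Real.exp (K * s) + (Real.exp (K * s) - 1)) := by field_simp
        _ ≤ δ * M := by rw [hM]; gcongr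
        _ ≤ _ := h2
    · have hr' : r < t + 1 := by linarith [hr.2]
      refine (hh r ⟨hr.1, hr'.le⟩).mono_of_mem_nhdsWithin ?_
      exact mem_of_superset (Icc_mem_nhdsGE hr') (Set.Icc_subset_Icc_left hr.1)
    · rw [truncField_eq U (by linarith [hgm r ⟨hr.1, hr.2.le⟩])]
      exact hg.hasDerivWithinAt_Ici hr.1 (hr.2.trans ht)
    · refine (dist_truncField_le U V hc r (g r)).trans ?_
      gcongr
      refine hVU _ ?_
      rw [Real.coe_toNNReal _ hr.1]
      exact hr.2.le
    · rw [hh0, hg.1, dist_eq_norm]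
      exact hwz
  have hfar : ∀ s ∈ Set.Icc 0 t, m / 4 < ‖h s - (V s.toNNReal : ℂ)‖ := by
    intro s hs
    have h1 := (hclose s hs).trans (min_le_right _ _)
    have h2 := hgm s hs
    have h3 : |V s.toNNReal - U s.toNNReal| ≤ m / 4 :=
      (hVU _ (by rw [Real.coe_toNNReal _ hs.1]; exact hs.2)).trans (min_le_left _ _)
    have h4 : ‖(V s.toNNReal : ℂ) - (U s.toNNReal : ℂ)‖ = |V s.toNNReal - U s.toNNReal| := by
      rw [← Complex.ofReal_sub, Complex.norm_real, Real.norm_eq_abs]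
    have h5 : g s - (U s.toNNReal : ℂ) = (h s - (V s.toNNReal : ℂ)) - (h s - g s)
        + ((V s.toNNReal : ℂ) - (U s.toNNReal : ℂ)) := by ring
    have h6 := norm_add_le ((h s - (V s.toNNReal : ℂ)) - (h s - g s))
      ((V s.toNNReal : ℂ) - (U s.toNNReal : ℂ))
    have h7 := norm_sub_le (h s - (V s.toNNReal : ℂ)) (h s - g s)
    rw [← h5] at h6
    linarith
  obtain ⟨T', hT', hs⟩ := of_truncField hV hc h0 (by linarith : t < t + 1) hh0 hh hfar
  exact ⟨T', h, hT', hs, (hclose t ⟨h0, le_rfl⟩).trans (min_le_left _ _)⟩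

end IsLoewnerSolution

/-! ### The Loewner map and the swallowing time -/

theorem loewnerMap_eq_some {U : ℝ≥0 → ℝ} (hU : Continuous U) {z : ℂ} {T : ℝ} {g : ℝ → ℂ}
    (hg : IsLoewnerSolution U z T g) {t : ℝ≥0} (ht : (t : ℝ) < T) :
    loewnerMap U t z = some (g t) := by
  have h : ∃ g : ℝ → ℂ, ∃ T : ℝ, (t : ℝ) < T ∧ IsLoewnerSolution U z T g := ⟨g, T, ht, hg⟩
  rw [loewnerMap, dif_pos h]
  obtain ⟨T', hT', hs⟩ := h.choose_spec
  exact congrArg some (hs.unique hU hg t.2 hT' ht)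

theorem loewnerMap_eq_none_iff {U : ℝ≥0 → ℝ} {z : ℂ} {t : ℝ≥0} :
    loewnerMap U t z = none ↔ ¬ ∃ g : ℝ → ℂ, ∃ T : ℝ, (t : ℝ) < T ∧ IsLoewnerSolution U z T g := by
  rw [loewnerMap]
  split_ifs with h <;> simp [h]

theorem loewnerMap_ne_none_iff {U : ℝ≥0 → ℝ} {z : ℂ} {t : ℝ≥0} :
    loewnerMap U t z ≠ none ↔ ∃ g : ℝ → ℂ, ∃ T : ℝ, (t : ℝ) < T ∧ IsLoewnerSolution U z T g := by
  rw [Ne, loewnerMap_eq_none_iff, not_not]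

/-- Solutions of the Loewner equation up to all times below `T` glue to a solution on `[0, T)`. -/
theorem isLoewnerSolution_loewnerMap {U : ℝ≥0 → ℝ} (hU : Continuous U) {z : ℂ} {T : ℝ}
    (hT : 0 < T) (h : ∀ s < T, ∃ s' > s, ∃ g, IsLoewnerSolution U z s' g) :
    IsLoewnerSolution U z T (fun s => (loewnerMap U s.toNNReal z).getD 0) := by
  have key : ∀ s' g, IsLoewnerSolution U z s' g → ∀ r : ℝ, 0 ≤ r → r < s' →
      (loewnerMap U r.toNNReal z).getD 0 = g r := by
    intro s' g hg r h0 hr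
    rw [loewnerMap_eq_some hU hg (by rwa [Real.coe_toNNReal _ h0]), Option.getD_some,
      Real.coe_toNNReal _ h0]
  refine ⟨?_, fun t h0 ht => ?_⟩
  · obtain ⟨s', hs', g, hg⟩ := h 0 hT
    exact (key s' g hg 0 le_rfl hs').trans hg.1
  · obtain ⟨s', hs', g, hg⟩ := h t ht
    have e := key s' g hg t h0 hs'
    obtain ⟨h1, h2⟩ := hg.2 t h0 hs'
    beta_reduce
    rw [e]
    refine ⟨h1, h2.congr_of_eventuallyEq ?_ e⟩
    filter_upwards [self_mem_nhdsWithin, mem_nhdsWithin_of_mem_nhds (Iio_mem_nhds hs')] with r hr hr'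
    exact key s' g hg r hr hr'

namespace IsLoewnerSolution

variable {U : ℝ≥0 → ℝ} {z : ℂ} {T : ℝ} {g : ℝ → ℂ}

/-- A solution that does not approach the driving function at its final time can be continued. -/
theorem exists_of_not_tendsto (hU : Continuous U) (hT : 0 < T) (hg : IsLoewnerSolution U z T g)
    (hn : ¬ Tendsto (fun t : ℝ => g t - (U t.toNNReal : ℂ)) (𝓝[<] T) (𝓝 0)) :
    ∃ T' h, T < T' ∧ IsLoewnerSolution U z T' h := by
  obtain ⟨ε, hε, hfr⟩ : ∃ ε > 0, ∃ᶠ t in 𝓝[<] T, ε ≤ ‖g t - (U t.toNNReal : ℂ)‖ := by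
    rw [Metric.tendsto_nhds] at hn
    push Not at hn
    obtain ⟨ε, hε, h⟩ := hn
    refine ⟨ε, hε, h.mono fun t ht => ?_⟩
    simpa using ht
  have hosc : ∀ᶠ s in 𝓝[<] T, ‖(U s.toNNReal : ℂ) - (U T.toNNReal : ℂ)‖ < ε / 16 := by
    have := ((continuous_driving_ofReal hU).tendsto T).mono_left (nhdsWithin_le_nhds (s := Set.Iio T))
    have := (Metric.tendsto_nhds.1 this) (ε / 16) (by positivity)
    simpa only [dist_eq_norm] using this
  obtain ⟨l, hl, hlsub⟩ := (mem_nhdsLT_iff_exists_Ioo_subset' hT).1 hosc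
  have hnear : ∀ᶠ s in 𝓝[<] T, s ∈ Set.Ioo (max (max l 0) (T - ε ^ 2 / 16)) T :=
    Ioo_mem_nhdsLT (max_lt (max_lt hl hT) (by linarith [show 0 < ε ^ 2 / 16 by positivity]))
  obtain ⟨r, hr, hrl, hrT⟩ := (hfr.and_eventually hnear).exists
  have hr0 : 0 < r := ((le_max_right l 0).trans (le_max_left _ _)).trans_lt hrl
  have hrl' : l < r := ((le_max_left l 0).trans (le_max_left _ _)).trans_lt hrl
  have hrδ : T - ε ^ 2 / 16 < r := (le_max_right _ _).trans_lt hrl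
  -- At time r the distance to the driver is at least ε. Until it first drops to ε/2 the speed of g
  -- is at most 4/ε, so within the remaining time ε²/16 the solution moves at most ε/4 and the
  -- driver less than ε/8: too little for such a drop.
  have hfar : ∀ s ∈ Set.Ico r T, ε / 2 ≤ ‖g s - (U s.toNNReal : ℂ)‖ := by
    intro s hs
    by_contra! hlt
    have hgc : ContinuousOn g (Set.Icc r s) :=
      (hg.continuousOn hs.2).mono (Set.Icc_subset_Icc_left hr0.le)
    have hcont : ContinuousOn (fun s => ‖g s - (U s.toNNReal : ℂ)‖) (Set.Icc r s) :=
      (hgc.sub (continuous_driving_ofReal hU).continuousOn).norm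
    obtain ⟨x, ⟨hx, hxle⟩, hxmin⟩ :=
      (isCompact_Icc.of_isClosed_subset (hcont.preimage_isClosed_of_isClosed isClosed_Icc
        (isClosed_Iic (a := ε / 2))) Set.inter_subset_left).exists_isLeast
        ⟨s, ⟨hs.1, le_rfl⟩, hlt.le⟩
    have hxT : x < T := hx.2.trans_lt hs.2
    have hd := norm_image_sub_le_of_norm_deriv_right_le_segment (C := 4 / ε)
      (hgc.mono (Set.Icc_subset_Icc_right hx.2))
      (fun y hy => hg.hasDerivWithinAt_Ici (hr0.le.trans hy.1) (hy.2.trans hxT))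
      (fun y hy => ?_) x ⟨hx.1, le_rfl⟩
    · have h1 : ‖(U x.toNNReal : ℂ) - (U T.toNNReal : ℂ)‖ < ε / 16 :=
        hlsub ⟨hrl'.trans_le hx.1, hxT⟩
      have h2 : ‖(U r.toNNReal : ℂ) - (U T.toNNReal : ℂ)‖ < ε / 16 := hlsub ⟨hrl', hrT⟩
      have h3 : 4 / ε * (x - r) ≤ ε / 4 := by
        calc 4 / ε * (x - r) ≤ 4 / ε * (ε ^ 2 / 16) := by gcongr; linarith
          _ = ε / 4 := by field_simp; norm_num
      have h4 : g r - (U r.toNNReal : ℂ) = (g x - (U x.toNNReal : ℂ)) - (g x - g r)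
          + (((U x.toNNReal : ℂ) - (U T.toNNReal : ℂ))
            - ((U r.toNNReal : ℂ) - (U T.toNNReal : ℂ))) := by ring
      have h5 := norm_add_le ((g x - (U x.toNNReal : ℂ)) - (g x - g r))
        (((U x.toNNReal : ℂ) - (U T.toNNReal : ℂ)) - ((U r.toNNReal : ℂ) - (U T.toNNReal : ℂ)))
      rw [← h4] at h5
      have h6 := norm_sub_le (g x - (U x.toNNReal : ℂ)) (g x - g r)
      have h7 := norm_sub_le ((U x.toNNReal : ℂ) - (U T.toNNReal : ℂ))
        ((U r.toNNReal : ℂ) - (U T.toNNReal : ℂ))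
      have h8 : ‖g x - (U x.toNNReal : ℂ)‖ ≤ ε / 2 := hxle
      linarith
    · have hy' : ε / 2 < ‖g y - (U y.toNNReal : ℂ)‖ := by
        by_contra! hle
        exact (hxmin ⟨⟨hy.1, hy.2.le.trans hx.2⟩, hle⟩).not_gt hy.2
      rw [norm_div, Complex.norm_ofNat]
      calc 2 / ‖g y - (U y.toNNReal : ℂ)‖ ≤ 2 / (ε / 2) := by gcongr
        _ = 4 / ε := by field_simp; norm_num
  obtain ⟨m, hm, hgm⟩ := hg.exists_lower_bound hU hrT
  refine hg.exists_of_lower_bound hU hT.le (lt_min hm (half_pos hε)) ?_ fun s hs => ?_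
  · have := (hg.2 0 le_rfl hT).1
    rw [hg.1, Real.toNNReal_zero] at this
    exact sub_ne_zero.1 this
  · rcases le_or_gt s r with hsr | hsr
    · exact (min_le_left _ _).trans (hgm s ⟨hs.1, hsr⟩)
    · exact (min_le_right _ _).trans (hfar s ⟨hsr.le, hs.2⟩)

/-- A point is swallowed no earlier than its solution stops to exist. -/
theorem le_of_isSwallowingTime (hU : Continuous U) (hT : 0 < T) (hg : IsLoewnerSolution U z T g)
    {τ : ℝ≥0} (hτ : IsSwallowingTime U z τ) : T ≤ τ := by
  obtain ⟨rfl, rfl⟩ | ⟨h0, h, hh, hlim⟩ := hτ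
  · have := (hg.2 0 le_rfl hT).1
    simp [hg.1] at this
  by_contra! hlt
  have h0' : (0 : ℝ) < τ := h0
  obtain ⟨hne, hd⟩ := hg.2 τ τ.2 hlt
  have hc : Tendsto (fun t : ℝ => g t - (U t.toNNReal : ℂ)) (𝓝[<] (τ : ℝ))
      (𝓝 (g τ - (U (τ : ℝ).toNNReal : ℂ))) := by
    have hda : HasDerivAt g _ (τ : ℝ) := hd.hasDerivAt (Ici_mem_nhds h0')
    exact (hda.continuousAt.sub (continuous_driving_ofReal hU).continuousAt).mono_left
      nhdsWithin_le_nhds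
  refine hne (tendsto_nhds_unique hc (hlim.congr' ?_))
  filter_upwards [Ioo_mem_nhdsLT h0'] with t ht
  rw [hg.unique hU hh ht.1.le (ht.2.trans hlt) ht.2]

end IsLoewnerSolution

/-- If g_t is undefined, the existence times are bounded by t. The glued solution up to their
supremum must approach the driver there, since otherwise it would continue further; the supremum is
thus a swallowing time. -/
theorem swallowingTime_le_iff {U : ℝ≥0 → ℝ} (hU : Continuous U) {z : ℂ} {t : ℝ≥0} :
    swallowingTime U z ≤ (t : ℝ≥0∞) ↔ loewnerMap U t z = none := by
  rw [loewnerMap_eq_none_iff]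
  constructor
  · rintro hle ⟨g, T, hT, hg⟩
    have hT0 : 0 < T := t.2.trans_lt hT
    have h1 : ((T.toNNReal : ℝ≥0) : ℝ≥0∞) ≤ swallowingTime U z := le_iInf₂ fun τ hτ => by
      rw [ENNReal.coe_le_coe, Real.toNNReal_le_iff_le_coe]
      exact hg.le_of_isSwallowingTime hU hT0 hτ
    have h2 := h1.trans hle
    rw [ENNReal.coe_le_coe, Real.toNNReal_le_iff_le_coe] at h2
    exact h2.not_gt hT
  · intro hn
    by_cases hz : z = (U 0 : ℂ)
    · exact (iInf₂_le (0 : ℝ≥0) (Or.inl ⟨rfl, hz⟩)).trans (by simp)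
    set S : Set ℝ := {s | 0 ≤ s ∧ ∃ g, IsLoewnerSolution U z s g} with hS
    have hbdd : ∀ s ∈ S, s ≤ t := fun s ⟨_, g, hg⟩ => by
      by_contra! hlt
      exact hn ⟨g, s, hlt, hg⟩
    have hB : BddAbove S := ⟨t, hbdd⟩
    -- A solution on the empty interval [0, 0); continuing it gives local existence.
    have hconst : IsLoewnerSolution U z 0 fun _ => z :=
      ⟨rfl, fun s h0 hs => absurd hs h0.not_gt⟩
    have h0S : (0 : ℝ) ∈ S := ⟨le_rfl, _, hconst⟩
    have hpos : 0 < sSup S := by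
      obtain ⟨T, h, hT, hh⟩ := hconst.exists_of_lower_bound hU le_rfl one_pos hz
        (fun s hs => absurd hs.2 hs.1.not_gt)
      exact hT.trans_le (le_csSup hB ⟨hT.le, h, hh⟩)
    have hg := isLoewnerSolution_loewnerMap hU hpos (z := z) (fun s hs => by
      obtain ⟨s', ⟨_, g, hg⟩, hlt⟩ := exists_lt_of_lt_csSup ⟨0, h0S⟩ hs
      exact ⟨s', hlt, g, hg⟩)
    have hle : (sSup S).toNNReal ≤ t := by
      rw [Real.toNNReal_le_iff_le_coe]
      exact csSup_le ⟨0, h0S⟩ hbdd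
    refine (iInf₂_le (sSup S).toNNReal (Or.inr ⟨Real.toNNReal_pos.2 hpos,
      fun s => (loewnerMap U s.toNNReal z).getD 0, ?_, ?_⟩)).trans (ENNReal.coe_le_coe.2 hle)
    · rwa [Real.coe_toNNReal _ hpos.le]
    · rw [Real.coe_toNNReal _ hpos.le]
      by_contra hlim
      obtain ⟨T', h, hT', hh⟩ := hg.exists_of_not_tendsto hU hpos hlim
      exact (le_csSup hB ⟨(hpos.trans hT').le, h, hh⟩).not_gt hT'

theorem loewnerHull_eq {U : ℝ≥0 → ℝ} (hU : Continuous U) (t : ℝ≥0) :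
    loewnerHull U t = {z : ℂ | 0 ≤ z.im ∧ loewnerMap U t z = none} :=
  Set.ext fun _ => and_congr_right fun _ => swallowingTime_le_iff hU

/-! ### Deterministic scaling of maps and hulls -/

/-- Brownian scaling of solutions of the Loewner equation. -/
theorem IsLoewnerSolution.scale {U : ℝ≥0 → ℝ} {z : ℂ} {T : ℝ} {g : ℝ → ℂ} {a : ℝ} {α : ℝ≥0}
    (ha : 0 < a) (hα : (α : ℝ) = a ^ 2) (hg : IsLoewnerSolution U z T g) :
    IsLoewnerSolution (fun t => a⁻¹ * U (α * t)) ((a⁻¹ : ℝ) * z) (T / α)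
      (fun s => (a⁻¹ : ℝ) * g (α * s)) := by
  have hα0 : (0 : ℝ) < α := by rw [hα]; positivity
  refine ⟨by simp [hg.1], fun t h0 ht => ?_⟩
  rw [lt_div_iff₀' hα0] at ht
  obtain ⟨hne, hd⟩ := hg.2 (α * t) (by positivity) ht
  have hac : (a : ℂ) ≠ 0 := by exact_mod_cast ha.ne'
  have e1 : (α * t : ℝ).toNNReal = α * t.toNNReal := by
    rw [Real.toNNReal_mul α.coe_nonneg, Real.toNNReal_coe]
  rw [e1] at hne hd
  have e2 : ((a⁻¹ : ℝ) : ℂ) * g (α * t) - ((a⁻¹ * U (α * t.toNNReal) : ℝ) : ℂ)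
      = (a : ℂ)⁻¹ * (g (α * t) - (U (α * t.toNNReal) : ℂ)) := by
    push_cast
    ring
  beta_reduce
  rw [e2]
  refine ⟨mul_ne_zero (inv_ne_zero hac) hne, ?_⟩
  have hlin : HasDerivWithinAt (fun s : ℝ => α * s) (α : ℝ) (Set.Ici 0) t := by
    simpa using (hasDerivWithinAt_id t (Set.Ici 0)).const_mul (α : ℝ)
  -- The chain rule gives the factor a⁻¹α = a, which is what 2/(a⁻¹(g − U)) requires.
  have := (hd.scomp t hlin (fun s hs => mul_nonneg α.2 hs)).const_mul ((a⁻¹ : ℝ) : ℂ)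
  refine this.congr_deriv ?_
  rw [Complex.real_smul, hα]
  push_cast
  field_simp

theorem loewnerMap_scale {U : ℝ≥0 → ℝ} (hU : Continuous U) {a : ℝ} {α : ℝ≥0} (ha : 0 < a)
    (hα : (α : ℝ) = a ^ 2) (t : ℝ≥0) (z : ℂ) :
    (loewnerMap U (α * t) ((a : ℂ) * z)).map (fun w : ℂ => ((a⁻¹ : ℝ) : ℂ) * w)
      = loewnerMap (fun s => a⁻¹ * U (α * s)) t z := by
  have hα0 : (0 : ℝ) < α := by rw [hα]; positivity
  have hα1 : α ≠ 0 := fun h => by simp [h] at hα0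
  have hac : (a : ℂ) ≠ 0 := by exact_mod_cast ha.ne'
  have hV : Continuous fun s => a⁻¹ * U (α * s) := by fun_prop
  by_cases h : loewnerMap U (α * t) ((a : ℂ) * z) = none
  · rw [h, Option.map_none, eq_comm, loewnerMap_eq_none_iff]
    -- A solution of the rescaled equation would scale back, with a⁻¹ and α⁻¹, to one of the
    -- original.
    rintro ⟨g, T, hT, hg⟩
    refine loewnerMap_eq_none_iff.1 h ?_
    have hs := hg.scale (a := a⁻¹) (α := α⁻¹) (inv_pos.2 ha) (by simp [hα])
    simp only [inv_inv, NNReal.coe_inv, div_inv_eq_mul] at hs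
    have e : (fun s => a * (a⁻¹ * U (α * (α⁻¹ * s)))) = U := by
      ext s
      rw [mul_inv_cancel_left₀ ha.ne', mul_inv_cancel_left₀ hα1]
    rw [e] at hs
    refine ⟨_, _, ?_, hs⟩
    rw [NNReal.coe_mul, mul_comm]
    gcongr
  · obtain ⟨g, T, hT, hg⟩ := loewnerMap_ne_none_iff.1 h
    have hs := hg.scale ha hα
    rw [Complex.ofReal_inv, inv_mul_cancel_left₀ hac] at hs
    rw [loewnerMap_eq_some hU hg hT, Option.map_some, loewnerMap_eq_some hV hs, NNReal.coe_mul,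
      Complex.ofReal_inv]
    rw [lt_div_iff₀' hα0]
    simpa using hT

theorem loewnerHull_scale {U : ℝ≥0 → ℝ} (hU : Continuous U) {a : ℝ} {α : ℝ≥0} (ha : 0 < a)
    (hα : (α : ℝ) = a ^ 2) (t : ℝ≥0) :
    PlaneSet.scale a⁻¹ (loewnerHull U (α * t)) = loewnerHull (fun s => a⁻¹ * U (α * s)) t := by
  have hac : (a : ℂ) ≠ 0 := by exact_mod_cast ha.ne'
  rw [loewnerHull_eq hU, loewnerHull_eq (by fun_prop)]
  refine Set.ext fun z => ?_
  have hmem : z ∈ {z : ℂ | 0 ≤ z.im ∧ loewnerMap (fun s => a⁻¹ * U (α * s)) t z = none}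
      ↔ (a : ℂ) * z ∈ {z : ℂ | 0 ≤ z.im ∧ loewnerMap U (α * t) z = none} := by
    simp only [Set.mem_ofPred_eq, ← loewnerMap_scale hU ha hα, Option.map_eq_none_iff,
      Complex.im_ofReal_mul, mul_nonneg_iff_of_pos_left ha]
  refine Iff.trans ?_ hmem.symm
  constructor
  · rintro ⟨w, hw, rfl⟩
    beta_reduce
    rwa [Complex.ofReal_inv, mul_inv_cancel_left₀ hac]
  · intro h
    refine ⟨_, h, ?_⟩
    beta_reduce
    rw [Complex.ofReal_inv, inv_mul_cancel_left₀ hac]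

/-! ### Measurability on path space -/

/-- The σ-algebra on the space of continuous paths generated by the evaluation maps. -/
instance : MeasurableSpace C(ℝ≥0, ℝ) :=
  MeasurableSpace.comap (fun f : C(ℝ≥0, ℝ) => (f : ℝ≥0 → ℝ)) inferInstance

theorem measurable_coe_path : Measurable fun f : C(ℝ≥0, ℝ) => (f : ℝ≥0 → ℝ) :=
  comap_measurable _

theorem measurable_path_iff {β : Type*} [MeasurableSpace β] {W : β → C(ℝ≥0, ℝ)} :
    Measurable W ↔ ∀ t, Measurable fun x => W x t := by
  rw [measurable_comap_iff, measurable_pi_iff]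
  rfl

theorem measurable_path_eval (t : ℝ≥0) : Measurable fun f : C(ℝ≥0, ℝ) => f t :=
  (measurable_pi_apply t).comp measurable_coe_path

/-- The compact image f(K) lies in the open set V iff it keeps a uniform positive distance from Vᶜ,
and by continuity this can be tested on a countable dense subset of K. -/
theorem measurableSet_mapsTo {K : Set ℝ≥0} (hK : IsCompact K) {V : Set ℝ} (hV : IsOpen V) :
    MeasurableSet {f : C(ℝ≥0, ℝ) | Set.MapsTo f K V} := by
  obtain ⟨D, hDc, hD⟩ := TopologicalSpace.exists_countable_dense K
  have : {f : C(ℝ≥0, ℝ) | Set.MapsTo f K V}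
      = ⋃ n : ℕ, ⋂ d ∈ D, {f : C(ℝ≥0, ℝ) | (n : ℝ≥0∞)⁻¹ ≤ Metric.infEDist (f d) Vᶜ} := by
    ext f
    have hc : Continuous fun x : K => Metric.infEDist (f x) Vᶜ :=
      Metric.continuous_infEDist.comp (f.continuous.comp continuous_subtype_val)
    simp only [Set.mem_iUnion, Set.mem_iInter]
    constructor
    · intro hf
      obtain h | h := isEmpty_or_nonempty K
      · exact ⟨0, fun d => (h.false d).elim⟩
      have : CompactSpace K := isCompact_iff_compactSpace.1 hK
      obtain ⟨x, -, hx⟩ := isCompact_univ.exists_isMinOn Set.univ_nonempty hc.continuousOn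
      have hpos : Metric.infEDist (f x) Vᶜ ≠ 0 := fun h0 => by
        have := (Metric.mem_closure_iff_infEDist_zero).2 h0
        rw [hV.isClosed_compl.closure_eq] at this
        exact this (hf x.2)
      obtain ⟨n, hn⟩ := ENNReal.exists_inv_nat_lt hpos
      exact ⟨n, fun d _ => hn.le.trans (hx (Set.mem_univ d))⟩
    · rintro ⟨n, hn⟩ x hx
      have hcl : IsClosed {x : K | (n : ℝ≥0∞)⁻¹ ≤ Metric.infEDist (f x) Vᶜ} :=
        isClosed_le continuous_const hc
      have hmem := closure_minimal (fun d hd => hn d hd) hcl (hD ⟨x, hx⟩)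
      by_contra hxV
      have h0 : Metric.infEDist (f x) Vᶜ = 0 := Metric.infEDist_zero_of_mem hxV
      have : (n : ℝ≥0∞)⁻¹ ≤ Metric.infEDist (f x) Vᶜ := hmem
      rw [h0] at this
      simp at this
  rw [this]
  refine MeasurableSet.iUnion fun n => MeasurableSet.biInter hDc fun d _ => ?_
  exact measurableSet_le measurable_const (measurable_infEDist.comp (measurable_path_eval d))

instance : OpensMeasurableSpace C(ℝ≥0, ℝ) where
  borel_le := by
    -- Second countability lets the compact-open subbasis generate all Borel sets.
    rw [borel_eq_generateFrom_of_subbasis (ContinuousMap.compactOpen_eq)]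
    refine MeasurableSpace.generateFrom_le ?_
    rintro _ ⟨K, hK, V, hV, rfl⟩
    exact measurableSet_mapsTo hK hV

theorem eventually_path_close (U : C(ℝ≥0, ℝ)) (t : ℝ≥0) {δ : ℝ} (hδ : 0 < δ) :
    ∀ᶠ V : C(ℝ≥0, ℝ) in 𝓝 U, ∀ s : ℝ≥0, (s : ℝ) ≤ t → |V s - U s| ≤ δ := by
  have h := ContinuousMap.tendsto_iff_forall_isCompact_tendstoUniformlyOn.1
    (tendsto_id (x := 𝓝 U)) (Set.Icc 0 t) isCompact_Icc
  filter_upwards [Metric.tendstoUniformlyOn_iff.1 h δ hδ] with V hV s hs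
  have := hV s ⟨zero_le, hs⟩
  rw [dist_comm, Real.dist_eq] at this
  exact this.le

/-- Closeness is joint in path and point; the hulls need this for the compactness argument over
starting points. -/
theorem eventually_loewnerMap_close {U : C(ℝ≥0, ℝ)} {t : ℝ≥0} {z : ℂ} {v : ℂ}
    (h : loewnerMap U t z = some v) {ε : ℝ} (hε : 0 < ε) :
    ∀ᶠ p : C(ℝ≥0, ℝ) × ℂ in 𝓝 (U, z), ∃ v', loewnerMap p.1 t p.2 = some v' ∧ ‖v' - v‖ ≤ ε := by
  obtain ⟨g, T, hT, hg⟩ := loewnerMap_ne_none_iff.1 (by rw [h]; simp)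
  obtain ⟨δ, hδ, H⟩ := hg.exists_of_close U.continuous t.2 hT hε
  rw [loewnerMap_eq_some U.continuous hg hT, Option.some_inj] at h
  have h1 := eventually_path_close U t hδ
  have h2 : ∀ᶠ w in 𝓝 z, ‖w - z‖ ≤ δ := by
    filter_upwards [Metric.closedBall_mem_nhds z hδ] with w hw
    rwa [← dist_eq_norm]
  rw [nhds_prod_eq]
  filter_upwards [h1.prod_mk h2] with p hp
  obtain ⟨T', h', hT', hs, hle⟩ := H p.1 p.1.continuous p.2 hp.1 hp.2
  exact ⟨h' t, loewnerMap_eq_some p.1.continuous hs hT', by rwa [← h]⟩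

theorem isOpen_setOf_loewnerMap_ne_none (t : ℝ≥0) :
    IsOpen {p : C(ℝ≥0, ℝ) × ℂ | loewnerMap p.1 t p.2 ≠ none} := by
  rw [isOpen_iff_eventually]
  rintro ⟨U, z⟩ hp
  obtain ⟨v, hv⟩ := Option.ne_none_iff_exists'.1 hp
  filter_upwards [eventually_loewnerMap_close hv one_pos] with p ⟨v', hv', _⟩
  change loewnerMap p.1 t p.2 ≠ none
  simp [hv']

/-- The map is continuous on an open set of paths and constantly `none` off it. -/
theorem measurable_loewnerMap (t : ℝ≥0) (z : ℂ) :
    Measurable fun U : C(ℝ≥0, ℝ) => loewnerMap U t z := by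
  classical
  set D : Set C(ℝ≥0, ℝ) := {U | loewnerMap U t z ≠ none} with hD
  have hDo : IsOpen D :=
    (isOpen_setOf_loewnerMap_ne_none t).preimage (Continuous.prodMk_left z)
  set f : C(ℝ≥0, ℝ) → ℂ := fun U => (loewnerMap U t z).getD 0 with hf
  have hfc : ContinuousOn f D := by
    intro U hU
    obtain ⟨v, hv⟩ := Option.ne_none_iff_exists'.1 hU
    refine ContinuousAt.continuousWithinAt (Metric.tendsto_nhds.2 fun ε hε => ?_)
    have h1 := eventually_loewnerMap_close hv (half_pos hε)
    have h2 := (Continuous.prodMk_left z).tendsto U |>.eventually h1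
    filter_upwards [h2] with V ⟨v', hv', hle⟩
    simp only [hf, hv, hv', Option.getD_some, dist_eq_norm]
    linarith
  have hfm : Measurable f := by
    have : f = D.piecewise f 0 := by
      ext1 U
      by_cases hU : U ∈ D
      · rw [Set.piecewise_eq_of_mem _ _ _ hU]
      · rw [Set.piecewise_eq_of_notMem _ _ _ hU]
        have : loewnerMap U t z = none := not_not.1 hU
        simp [hf, this]
    rw [this]
    exact hfc.measurable_piecewise continuousOn_const hDo.measurableSet
  intro S hS
  have hS' : MeasurableSet (some ⁻¹' S : Set ℂ) := hS
  have : (fun U : C(ℝ≥0, ℝ) => loewnerMap U t z) ⁻¹' S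
      = (D ∩ f ⁻¹' (some ⁻¹' S)) ∪ (Dᶜ ∩ {_U | none ∈ S}) := by
    ext U
    rcases h : loewnerMap U t z with _ | v <;> simp [hD, hf, h]
  rw [this]
  exact (hDo.measurableSet.inter (hfm hS')).union (hDo.measurableSet.compl.inter (.const _))

theorem measurable_loewnerHull (t : ℝ≥0) :
    Measurable fun U : C(ℝ≥0, ℝ) => loewnerHull U t := by
  refine measurable_generateFrom ?_
  rintro _ ⟨C, hC, rfl⟩
  have hC' : IsCompact (C ∩ {z : ℂ | 0 ≤ z.im}) :=
    hC.inter_right (isClosed_le continuous_const Complex.continuous_im)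
  have : (fun U : C(ℝ≥0, ℝ) => loewnerHull U t) ⁻¹'
      {K : PlaneSet | ∃ z : ℂ, z ∈ (show Set ℂ from K) ∧ z ∈ C}
      = {U : C(ℝ≥0, ℝ) | ∀ z ∈ C ∩ {z : ℂ | 0 ≤ z.im}, loewnerMap U t z ≠ none}ᶜ := by
    ext U
    have e : (U ∈ (fun U : C(ℝ≥0, ℝ) => loewnerHull U t) ⁻¹'
        {K : PlaneSet | ∃ z : ℂ, z ∈ (show Set ℂ from K) ∧ z ∈ C})
        ↔ ∃ z : ℂ, (0 ≤ z.im ∧ loewnerMap U t z = none) ∧ z ∈ C := by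
      simp only [Set.mem_preimage, loewnerHull_eq U.continuous]
      rfl
    rw [e]
    simp only [Set.mem_compl_iff, Set.mem_ofPred_eq, not_forall, not_not, Set.mem_inter_iff]
    exact exists_congr fun z => by tauto
  rw [this]
  refine (IsOpen.measurableSet ?_).compl
  rw [isOpen_iff_eventually]
  intro U hU
  -- Tube lemma: openness at each (U, z) gives one neighbourhood of U valid for all z in the compact
  -- set.
  refine hC'.eventually_forall_of_forall_eventually fun z hz => ?_
  exact (isOpen_iff_eventually.1 (isOpen_setOf_loewnerMap_ne_none t)) (U, z) (hU z hz)

/-! ### Brownian paths and equality of laws -/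

/-- The path `s ↦ b f(α s)`. -/
def rescalePath (b : ℝ) (α : ℝ≥0) (f : C(ℝ≥0, ℝ)) : C(ℝ≥0, ℝ) where
  toFun s := b * f (α * s)

theorem measurable_rescalePath (b : ℝ) (α : ℝ≥0) : Measurable (rescalePath b α) :=
  measurable_path_iff.2 fun t => (measurable_path_eval (α * t)).const_mul b

theorem driving_eq_rescalePath {Ω : Type*} {B : ℝ≥0 → Ω → ℝ} {κ : ℝ} {ω : Ω}
    {f : C(ℝ≥0, ℝ)} (h : ∀ t, f t = B t ω) :
    driving κ B ω = rescalePath √κ 1 f := by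
  ext t
  simp [driving, rescalePath, h]

variable {Ω : Type*} [MeasurableSpace Ω] {P : Measure Ω} {B : ℝ≥0 → Ω → ℝ}

/-- A Brownian motion agrees almost surely with a random element of the path space. -/
theorem exists_measurable_path (hB : IsBrownianReal B P) :
    ∃ W : Ω → C(ℝ≥0, ℝ), Measurable W ∧ ∀ᵐ ω ∂P, ∀ t, W ω t = B t ω := by
  classical
  set q := TopologicalSpace.denseSeq ℝ≥0
  -- Only countably many measurable versions are used, so one full-measure set serves all of them;
  -- continuity recovers the other times as limits.
  have hae : ∀ᵐ ω ∂P, Continuous (B · ω) ∧ ∀ n, B (q n) ω = (hB.aemeasurable (q n)).mk _ ω :=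
    hB.cont.and (ae_all_iff.2 fun n => (hB.aemeasurable (q n)).ae_eq_mk)
  obtain ⟨G, hGae, hG, hGs⟩ := hae.exists_measurable_mem
  refine ⟨fun ω => if h : ω ∈ G then ⟨(B · ω), (hGs _ h).1⟩ else 0, ?_, ?_⟩
  · rw [measurable_path_iff]
    intro t
    obtain ⟨u, hu, hut⟩ := mem_closure_iff_seq_limit.1 (TopologicalSpace.denseRange_denseSeq ℝ≥0 t)
    choose n hn using hu
    refine measurable_of_tendsto_metrizable
      (f := fun k => G.indicator ((hB.aemeasurable (q (n k))).mk _))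
      (fun k => (hB.aemeasurable _).measurable_mk.indicator hG) ?_
    rw [tendsto_pi_nhds]
    intro ω
    by_cases h : ω ∈ G
    · simp only [Set.indicator_of_mem h, dif_pos h, ContinuousMap.coe_mk, ← (hGs ω h).2]
      have := ((hGs ω h).1.tendsto t).comp hut
      refine this.congr fun k => ?_
      simp only [Function.comp_apply, ← hn k]
      rfl
    · simp [h]
  · filter_upwards [hGae] with ω h t
    simp [dif_pos h]

/-- Two random paths that are both pre-Brownian have the same law on the path space. -/
theorem identDistrib_path {W W' : Ω → C(ℝ≥0, ℝ)} (hW : Measurable W) (hW' : Measurable W')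
    (h : IsPreBrownianReal (fun t ω => W ω t) P) (h' : IsPreBrownianReal (fun t ω => W' ω t) P) :
    IdentDistrib W W' P P := by
  have := (h.hasLaw_eval 0).isProbabilityMeasure
  have hc : Measurable fun ω t => W ω t := measurable_coe_path.comp hW
  have hc' : Measurable fun ω t => W' ω t := measurable_coe_path.comp hW'
  have hlaw : P.map (fun ω t => W ω t) = P.map (fun ω t => W' ω t) :=
    (map_eq_iff_forall_finset_map_restrict_eq hc.aemeasurable hc'.aemeasurable).2 fun I =>
      (h.hasLaw I).map_eq.trans (h'.hasLaw I).map_eq.symm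
  refine ⟨hW.aemeasurable, hW'.aemeasurable, Measure.ext ?_⟩
  -- Every measurable set of paths is pulled back from the product space, where the
  -- finite-dimensional laws determine the measure.
  rintro _ ⟨A, hA, rfl⟩
  rw [Measure.map_apply hW (measurable_coe_path hA), Measure.map_apply hW' (measurable_coe_path hA)]
  have := congrArg (fun μ => μ A) hlaw
  rwa [Measure.map_apply hc hA, Measure.map_apply hc' hA] at this

/-- Functionals of the driving path that agree after Brownian rescaling have the same law. -/
theorem identDistrib_of_rescale (hB : IsBrownianReal B P) {α : ℝ≥0} (hα : α ≠ 0)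
    {γ : Type*} [MeasurableSpace γ] {Φ : C(ℝ≥0, ℝ) → γ} (hΦ : Measurable Φ) (c : ℝ)
    {X Y : Ω → γ}
    (hX : ∀ ω, ∀ f : C(ℝ≥0, ℝ), (∀ t, f t = B t ω) →
      X ω = Φ (rescalePath (√(α : ℝ))⁻¹ α (rescalePath c 1 f)))
    (hY : ∀ ω, ∀ f : C(ℝ≥0, ℝ), (∀ t, f t = B t ω) → Y ω = Φ (rescalePath c 1 f)) :
    IdentDistrib X Y P P := by
  obtain ⟨W, hW, hWB⟩ := exists_measurable_path hB
  have hW' : Measurable fun ω => rescalePath (√(α : ℝ))⁻¹ α (W ω) :=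
    (measurable_rescalePath _ _).comp hW
  have hpre : IsPreBrownianReal (fun t ω => W ω t) P :=
    hB.toIsPreBrownianReal.congr fun t => hWB.mono fun ω h => (h t).symm
  have hid := (identDistrib_path hW' hW (hpre.smul hα) hpre).comp
    (hΦ.comp (measurable_rescalePath c 1))
  have e1 : (Φ ∘ rescalePath c 1) ∘ (fun ω => rescalePath (√(α : ℝ))⁻¹ α (W ω)) =ᵐ[P] X := by
    filter_upwards [hWB] with ω h
    rw [hX ω (W ω) h]
    -- Multiplication by c commutes with Brownian rescaling.
    refine congrArg Φ (ContinuousMap.ext fun t => ?_)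
    simp only [rescalePath, ContinuousMap.coe_mk, one_mul]
    ring
  have e2 : (Φ ∘ rescalePath c 1) ∘ W =ᵐ[P] Y := by
    filter_upwards [hWB] with ω h
    rw [hY ω (W ω) h]
    rfl
  exact ((IdentDistrib.of_ae_eq hid.aemeasurable_fst e1).symm.trans hid).trans
    (IdentDistrib.of_ae_eq hid.aemeasurable_snd e2)

end ChordalSLE
end

theorem mainTheorem9 {Ω : Type*} [MeasurableSpace Ω] (P : Measure Ω) (B : ℝ≥0 → Ω → ℝ)
    (hB : IsBrownianReal B P) (κ : ℝ) (hκ : 0 < κ) (α : ℝ≥0) (hα : 0 < α) :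
    IdentDistrib
      (fun (ω : Ω) (p : ℝ≥0 × ChordalSLE.PuncturedHalfPlane) =>
        (ChordalSLE.sleMap κ B ω (α * p.1) ((√(α : ℝ) : ℂ) * (p.2 : ℂ))).map
          (fun w : ℂ => (((√(α : ℝ))⁻¹ : ℝ) : ℂ) * w))
      (fun (ω : Ω) (p : ℝ≥0 × ChordalSLE.PuncturedHalfPlane) =>
        ChordalSLE.sleMap κ B ω p.1 (p.2 : ℂ))
      P P ∧
    IdentDistrib
      (fun (ω : Ω) (t : ℝ≥0) =>
        ChordalSLE.PlaneSet.scale (√(α : ℝ))⁻¹ (ChordalSLE.sleHull κ B ω (α * t)))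
      (fun (ω : Ω) (t : ℝ≥0) => ChordalSLE.sleHull κ B ω t)
      P P := by
  have hα' : (0 : ℝ) < α := hα
  have ha : 0 < √(α : ℝ) := Real.sqrt_pos.2 hα'
  have hsq : (α : ℝ) = √(α : ℝ) ^ 2 := (Real.sq_sqrt hα'.le).symm
  refine ⟨ChordalSLE.identDistrib_of_rescale hB hα.ne'
    (Φ := fun U p => ChordalSLE.loewnerMap U p.1 (p.2 : ℂ))
    (measurable_pi_iff.2 fun p => ChordalSLE.measurable_loewnerMap _ _) √κ
    (fun ω f hf => funext fun p => ?_) (fun ω f hf => funext fun p => ?_),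
    ChordalSLE.identDistrib_of_rescale hB hα.ne' (Φ := fun U t => ChordalSLE.loewnerHull U t)
    (measurable_pi_iff.2 fun t => ChordalSLE.measurable_loewnerHull _) √κ
    (fun ω f hf => funext fun t => ?_) (fun ω f hf => funext fun t => ?_)⟩
  · rw [ChordalSLE.sleMap, ChordalSLE.driving_eq_rescalePath hf]
    exact ChordalSLE.loewnerMap_scale (ContinuousMap.continuous _) ha hsq _ _
  · rw [ChordalSLE.sleMap, ChordalSLE.driving_eq_rescalePath hf]
  · rw [ChordalSLE.sleHull, ChordalSLE.driving_eq_rescalePath hf]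
    exact ChordalSLE.loewnerHull_scale (ContinuousMap.continuous _) ha hsq _
  · rw [ChordalSLE.sleHull, ChordalSLE.driving_eq_rescalePath hf]
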